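/- Let $n\geq 1$ and let $X,X_1,\ldots,X_n$ be real random variables on a probability space, such that $X_1,\ldots,X_n$ are independent, each $X_i$ has the same distribution as $X$, and $\mathbb{E}X=0$, $\mathbb{E}X^2=1$ and $\mathbb{E}X^8<\infty$. Let $$W=\frac{1}{n}\Big(\sum_{i=1}^n X_i\Big)^2 .$$ Let $h:[0,\infty)\to\mathbb{R}$ be bounded and continuous, and suppose that $h$ is three times differentiable on $(0,\infty)$ and that $h'$, $h''$ and $h^{(3)}$ are bounded there. Write $\|u\|=\sup_{x>0}|u(x)|$, and let $\chi^2_{(1)}h$ denote $\mathbb{E}h(T)$ for a random variable $T$ with the chi-square distribution with one degree of freedom, i.e. with density $(2\pi x)^{-1/2}\mathrm{e}^{-x/2}$ on $(0,\infty)$. Then $$|\mathbb{E}h(W)-\chi^2_{(1)}h|\leq\frac{4\,\mathbb{E}X^8}{3n}\big\{\alpha_0\|h\|+\alpha_1\|h'\|+\alpha_2\|h''\|+\alpha_3\|h^{(3)}\|\big\},$$ where $$\alpha_0=2+69|\mathbb{E}X^3|,\qquad \alpha_1=38+654|\mathbb{E}X^3|,\qquad \alpha_2=203+1781|\mathbb{E}X^3|,\qquad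 \alpha_3=321+1320|\mathbb{E}X^3| .$$ -/

import Mathlib

open MeasureTheory ProbabilityTheory

/-- The chi-square distribution with `p` degrees of freedom: the gamma distribution with
shape `p / 2` and rate `1 / 2`, that is, with density
`(1/2)^(p/2) / Γ(p/2) * x^(p/2 - 1) * exp (-x/2)` on the positive half-line. -/
noncomputable def chiSquareMeasure (p : ℝ) : Measure ℝ :=
  gammaMeasure (p / 2) (1 / 2)

/-- The class `C_b^k` of the half-line, for `k ≥ 1`. A function on `[0, ∞)` is given by a function
on `ℝ` whose values at negative points are irrelevant: all conditions concern `[0, ∞)` only, and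
for `x > 0` the number `iteratedDeriv j h x` depends only on `h` near `x`.
The function is bounded, has derivatives up to order `k` on `(0, ∞)`, and these are bounded
(the `k`-th derivative need not be continuous). At the end point `0` only continuity is asked for,
so that functions with one-sided derivatives at `0` belong to the class, as do the continuous
extensions to `0` of functions that are given on `(0, ∞)`. -/
structure IsCbHalfLine (k : ℕ) (h : ℝ → ℝ) : Prop where
  continuousOn : ContinuousOn h (Set.Ici 0)
  differentiableOn : ∀ j < k, DifferentiableOn ℝ (iteratedDeriv j h) (Set.Ioi 0)
  bounded : ∀ j ≤ k, ∃ C : ℝ, ∀ x : ℝ, 0 < x → |iteratedDeriv j h x| ≤ C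

/-- The supremum norm `‖f‖ = sup_{x > 0} |f x|` of a function on the half-line. -/
noncomputable def halfLineSupNorm (f : ℝ → ℝ) : ℝ :=
  ⨆ x : Set.Ioi (0 : ℝ), |f x|

open Filter Topology

/-! Write `W = S ^ 2` with `S = ∑ ξ i`, `ξ i = d * X i`, `d ^ 2 = 1 / n`, and the chi-square
variable as `Z ^ 2` with `Z` standard normal. The claim becomes a normal approximation for the even
test function `H s = h (s ^ 2)`, and evenness is what improves the usual rate `d` to `d ^ 2`.

Let `G` solve the Stein equation `G' - s G = H - E H(Z)`. Split off one summand, `S = Y + ξ`, and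
Taylor expand in `ξ`. Independence and the first two moments cancel everything up to a term `-(1/2)
d ^ 3 γ E G''(Y)`, with `γ` the third moment of `X`, and an error of order `d ^ 4`
(`stein_second_order`). Since `H` is even, `G` and `G''` are odd, so `E G''(Z) = 0`. A second Stein
equation, with right-hand side `G''`, then gives `E G''(S) = O(d)` (`stein_first_order`), and
`shift_bound` carries this over to `Y`. Each summand contributes `O(d ^ 4)`, and there are `n = d ^
(-2)` of them.

The explicit constants come from a comparison principle for `U' = s U + K` (`stein_abs_le`). Each
derivative of a Stein solution solves an equation of this form with a new source, so the principle
is applied repeatedly. As `h` need not be differentiable at `0`, the argument is run for `h (s ^ 2 +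
ε)`, with bounds free of `ε`, and then `ε → 0`. -/

/-! ### Comparison principle for `U' = s U + K` -/

lemma hasDerivAt_exp_neg_sq_half (s : ℝ) :
    HasDerivAt (fun s : ℝ => Real.exp (-s ^ 2 / 2)) (-s * Real.exp (-s ^ 2 / 2)) s := by
  have h1 : HasDerivAt (fun s : ℝ => -s ^ 2 / 2) (-s) s := by
    have := ((hasDerivAt_pow 2 s).neg).div_const 2
    refine this.congr_deriv ?_
    norm_num
    ring
  exact h1.exp.congr_deriv (by ring)

lemma hasDerivAt_exp_sq_half (s : ℝ) :
    HasDerivAt (fun s : ℝ => Real.exp (s ^ 2 / 2)) (s * Real.exp (s ^ 2 / 2)) s := by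
  have h1 : HasDerivAt (fun s : ℝ => s ^ 2 / 2) s s := by
    have := (hasDerivAt_pow 2 s).div_const 2
    refine this.congr_deriv ?_
    norm_num
  exact h1.exp.congr_deriv (by ring)

/-- One-sided comparison principle for the Stein equation of the normal distribution. -/
lemma stein_le_of_nonneg {U K : ℝ → ℝ} {A B C : ℝ} (hA : 0 ≤ A) (hB : 0 ≤ B)
    (hU : ∀ s, HasDerivAt U (s * U s + K s) s)
    (hK : ∀ s, 0 ≤ s → -(A + C * s + B * s ^ 2) ≤ K s)
    (hlim : Tendsto (fun s => U s * Real.exp (-s ^ 2 / 2)) atTop (𝓝 0))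
    (hlim' : Tendsto (fun s : ℝ => (2 * (A + B) / (1 + s) + C + B * s) * Real.exp (-s ^ 2 / 2))
      atTop (𝓝 0))
    {s : ℝ} (hs : 0 ≤ s) :
    U s ≤ 2 * (A + B) / (1 + s) + C + B * s := by
  -- The barrier is a supersolution: multiplied by the integrating factor, barrier minus `U`
  -- decreases to `0` at infinity, hence is nonnegative.
  set V : ℝ → ℝ := fun s => ((2 * (A + B) / (1 + s) + C + B * s) - U s) * Real.exp (-s ^ 2 / 2)
    with hV
  have hd : ∀ s, 0 ≤ s → HasDerivAt V
      ((-(2 * (A + B)) / (1 + s) ^ 2 + B - s * (2 * (A + B) / (1 + s) + C + B * s) - K s)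
        * Real.exp (-s ^ 2 / 2)) s := by
    intro s hs
    have h1 : HasDerivAt (fun s : ℝ => 2 * (A + B) / (1 + s)) (-(2 * (A + B)) / (1 + s) ^ 2) s := by
      have := ((hasDerivAt_id s).const_add 1).fun_inv (by simp only [id]; positivity)
      refine ((this.const_mul (2 * (A + B))).congr_of_eventuallyEq ?_).congr_deriv ?_
      · exact Eventually.of_forall fun x => by simp [div_eq_mul_inv]
      · simp only [id]; ring
    have h2 := (h1.add_const C).add ((hasDerivAt_id s).const_mul B)
    refine ((h2.sub (hU s)).mul (hasDerivAt_exp_neg_sq_half s)).congr_deriv ?_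
    simp only [id, Pi.sub_apply, Pi.add_apply]
    ring
  have hneg : ∀ s, 0 ≤ s →
      (-(2 * (A + B)) / (1 + s) ^ 2 + B - s * (2 * (A + B) / (1 + s) + C + B * s) - K s)
        * Real.exp (-s ^ 2 / 2) ≤ 0 := by
    intro s hs
    refine mul_nonpos_of_nonpos_of_nonneg ?_ (Real.exp_pos _).le
    -- After clearing denominators this is `0 ≤ 1 + s ^ 2`. It explains the factor 2 in the barrier,
    -- whose first term absorbs `A` and the derivative `B` of the last term.
    have key : 1 ≤ 2 / (1 + s) ^ 2 + s * 2 / (1 + s) := by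
      rw [div_add_div _ _ (by positivity) (by positivity), le_div_iff₀ (by positivity)]
      have : 0 ≤ (1 + s) * (1 + s ^ 2) := by positivity
      nlinarith
    have := mul_le_mul_of_nonneg_left key (add_nonneg hA hB)
    have h3 := hK s hs
    have e : -(2 * (A + B)) / (1 + s) ^ 2 + B - s * (2 * (A + B) / (1 + s) + C + B * s) - K s
      = -((A + B) * (2 / (1 + s) ^ 2 + s * 2 / (1 + s))) + B - C * s - B * s ^ 2 - K s := by ring
    rw [e]
    linarith
  have hanti : AntitoneOn V (Set.Ici 0) := by
    refine antitoneOn_of_deriv_nonpos (convex_Ici 0)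
      (fun x hx => (hd x hx).continuousAt.continuousWithinAt)
      (fun x hx => ?_) (fun x hx => ?_)
    · rw [interior_Ici] at hx
      exact (hd x (le_of_lt hx)).differentiableAt.differentiableWithinAt
    · rw [interior_Ici] at hx
      rw [(hd x (le_of_lt hx)).deriv]
      exact hneg x (le_of_lt hx)
  have hVlim : Tendsto V atTop (𝓝 0) := by
    have := hlim'.sub hlim
    simp only [sub_zero] at this
    refine this.congr fun x => ?_
    simp only [hV]; ring
  have h0 : 0 ≤ V s := by
    refine le_of_tendsto hVlim ?_
    filter_upwards [eventually_ge_atTop s] with t ht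
    exact hanti hs (hs.trans ht) ht
  have := nonneg_of_mul_nonneg_left h0 (Real.exp_pos _)
  linarith

lemma tendsto_quadratic_mul_exp (c : ℝ) :
    Tendsto (fun s : ℝ => c * (1 + s ^ 2) * Real.exp (-s ^ 2 / 2)) (cocompact ℝ) (𝓝 0) := by
  have h0 := tendsto_rpow_abs_mul_exp_neg_mul_sq_cocompact (a := 1 / 2) (by norm_num) 0
  have h2 := tendsto_rpow_abs_mul_exp_neg_mul_sq_cocompact (a := 1 / 2) (by norm_num) 2
  have := (h0.add h2).const_mul c
  simp only [add_zero, mul_zero] at this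
  refine this.congr fun s => ?_
  rw [Real.rpow_zero, Real.rpow_two, sq_abs, show -s ^ 2 / 2 = -(1 / 2) * s ^ 2 by ring]
  ring

lemma tendsto_mul_exp_of_quadratic_bound {U : ℝ → ℝ} {c : ℝ} (h : ∀ s, |U s| ≤ c * (1 + s ^ 2)) :
    Tendsto (fun s => U s * Real.exp (-s ^ 2 / 2)) (cocompact ℝ) (𝓝 0) := by
  refine squeeze_zero_norm (fun s => ?_) (tendsto_quadratic_mul_exp c)
  rw [norm_mul, Real.norm_eq_abs, Real.norm_of_nonneg (Real.exp_pos _).le]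
  exact mul_le_mul_of_nonneg_right (h s) (Real.exp_pos _).le

lemma integrable_mul_exp_of_quadratic_bound {U : ℝ → ℝ} {c : ℝ} (hU : Continuous U)
    (h : ∀ s, |U s| ≤ c * (1 + s ^ 2)) :
    Integrable (fun s => U s * Real.exp (-s ^ 2 / 2)) := by
  have h0 := integrable_exp_neg_mul_sq (b := 1 / 2) (by norm_num)
  have h2 := integrable_rpow_mul_exp_neg_mul_sq (b := 1 / 2) (by norm_num) (s := 2) (by norm_num)
  have h3 := (h0.add h2).const_mul c
  refine h3.mono' (by fun_prop) (Eventually.of_forall fun s => ?_)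
  rw [norm_mul, Real.norm_eq_abs, Real.norm_of_nonneg (Real.exp_pos _).le]
  refine (mul_le_mul_of_nonneg_right (h s) (Real.exp_pos _).le).trans (le_of_eq ?_)
  simp only [Pi.add_apply, Real.rpow_two]
  rw [show -s ^ 2 / 2 = -(1 / 2) * s ^ 2 by ring]
  ring

lemma tendsto_barrier_mul_exp {A B C : ℝ} (hA : 0 ≤ A) (hB : 0 ≤ B) (hC : 0 ≤ C) :
    Tendsto (fun s : ℝ => (2 * (A + B) / (1 + |s|) + C + B * |s|) * Real.exp (-s ^ 2 / 2))
      (cocompact ℝ) (𝓝 0) := by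
  refine tendsto_mul_exp_of_quadratic_bound (c := 2 * (A + B) + C + B) fun s => ?_
  rw [abs_of_nonneg (by positivity)]
  have h1 : 2 * (A + B) / (1 + |s|) ≤ 2 * (A + B) :=
    div_le_self (by positivity) (by linarith [abs_nonneg s])
  have h2 : |s| ≤ 1 + s ^ 2 := by nlinarith [sq_abs s, sq_nonneg (|s| - 1)]
  have h3 : 1 ≤ 1 + s ^ 2 := by nlinarith [sq_nonneg s]
  nlinarith [mul_le_mul_of_nonneg_left h2 hB, mul_le_mul_of_nonneg_left h3 hC,
    mul_le_mul_of_nonneg_left h3 hA, mul_le_mul_of_nonneg_left h3 hB]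

/-- Comparison principle for the Stein equation of the normal distribution. -/
lemma stein_abs_le {U K : ℝ → ℝ} {A B C : ℝ} (hA : 0 ≤ A) (hB : 0 ≤ B) (hC : 0 ≤ C)
    (hU : ∀ s, HasDerivAt U (s * U s + K s) s)
    (hK : ∀ s, |K s| ≤ A + C * |s| + B * s ^ 2)
    (hlim : Tendsto (fun s => U s * Real.exp (-s ^ 2 / 2)) (cocompact ℝ) (𝓝 0)) (s : ℝ) :
    |U s| ≤ 2 * (A + B) / (1 + |s|) + C + B * |s| := by
  have hbar : Tendsto (fun s : ℝ => (2 * (A + B) / (1 + s) + C + B * s) * Real.exp (-s ^ 2 / 2))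
      atTop (𝓝 0) := by
    refine ((tendsto_barrier_mul_exp hA hB hC).mono_left atTop_le_cocompact).congr' ?_
    filter_upwards [eventually_ge_atTop 0] with t ht
    rw [abs_of_nonneg ht]
  -- the bound on the positive half-line, for both signs
  have main : ∀ (U K : ℝ → ℝ), (∀ s, HasDerivAt U (s * U s + K s) s) →
      (∀ s, |K s| ≤ A + C * |s| + B * s ^ 2) →
      Tendsto (fun s => U s * Real.exp (-s ^ 2 / 2)) (cocompact ℝ) (𝓝 0) → ∀ s, 0 ≤ s →
      |U s| ≤ 2 * (A + B) / (1 + |s|) + C + B * |s| := by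
    intro U K hU hK hlim s hs
    have hlim1 := hlim.mono_left atTop_le_cocompact
    rw [abs_of_nonneg hs, abs_le]
    constructor
    · have := stein_le_of_nonneg (U := fun s => -U s) (K := fun s => -K s) (C := C) hA hB
        (fun s => ((hU s).neg).congr_deriv (by ring))
        (fun s hs => by have := (abs_le.1 (hK s)).2; rw [abs_of_nonneg hs] at this; linarith)
        (by simpa using hlim1.neg) hbar hs
      linarith
    · exact stein_le_of_nonneg hA hB hU
        (fun s hs => by have := (abs_le.1 (hK s)).1; rw [abs_of_nonneg hs] at this; linarith)
        hlim1 hbar hs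
  rcases le_total 0 s with hs | hs
  · exact main U K hU hK hlim s hs
  -- The reflection `-U (-s)` solves the equation with source `K (-s)`.
  · have := main (fun s => -U (-s)) (fun s => K (-s)) ?_ ?_ ?_ (-s) (by linarith)
    · simpa using this
    · intro s
      have h1 := ((hU (-s)).scomp s (hasDerivAt_neg s)).neg
      refine h1.congr_deriv ?_
      simp only [smul_eq_mul]; ring
    · intro s; simpa using hK (-s)
    · have hneg : Tendsto (fun s : ℝ => -s) (cocompact ℝ) (cocompact ℝ) :=
        (Homeomorph.neg ℝ).isClosedEmbedding.tendsto_cocompact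
      simpa [Function.comp_def] using (hlim.comp hneg).neg

/-! ### Existence of a Stein solution -/

lemma exists_stein_solution {K : ℝ → ℝ} {c : ℝ} (hK : Continuous K)
    (hb : ∀ s, |K s| ≤ c * (1 + s ^ 2)) (h0 : ∫ s, K s ∂(gaussianReal 0 1) = 0) :
    ∃ U : ℝ → ℝ, (∀ s, HasDerivAt U (s * U s + K s) s) ∧
      Tendsto (fun s => U s * Real.exp (-s ^ 2 / 2)) (cocompact ℝ) (𝓝 0) := by
  set g : ℝ → ℝ := fun s => K s * Real.exp (-s ^ 2 / 2) with hg
  have hgi : Integrable g := integrable_mul_exp_of_quadratic_bound hK hb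
  have hgc : Continuous g := by fun_prop
  have hg0 : ∫ s, g s = 0 := by
    rw [integral_gaussianReal_eq_integral_smul (by norm_num)] at h0
    simp only [gaussianPDFReal, smul_eq_mul, NNReal.coe_one, mul_one, sub_zero, mul_assoc] at h0
    rw [integral_const_mul] at h0
    have h1 : (√(2 * Real.pi))⁻¹ ≠ 0 := by positivity
    have h2 := (mul_eq_zero.1 h0).resolve_left h1
    rw [← h2]
    exact integral_congr_ae (Eventually.of_forall fun s => mul_comm _ _)
  have hsplit : (∫ s in Set.Iic 0, g s) + ∫ s in Set.Ioi 0, g s = 0 := by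
    rw [← hg0]
    exact intervalIntegral.integral_Iic_add_Ioi hgi.integrableOn hgi.integrableOn
  -- This is `exp (s ^ 2 / 2)` times the integral of `g` over `(-∞, s]`. That integral vanishes at
  -- `-∞` trivially and at `+∞` because `K` has Gaussian mean zero.
  refine ⟨fun s => Real.exp (s ^ 2 / 2) * ((∫ s in Set.Iic 0, g s) + ∫ t in (0 : ℝ)..s, g t),
    fun s => ?_, ?_⟩
  · have h1 : HasDerivAt (fun s => ∫ t in (0 : ℝ)..s, g t) (g s) s :=
      intervalIntegral.integral_hasDerivAt_right (hgc.intervalIntegrable _ _)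
        (hgc.stronglyMeasurableAtFilter _ _) hgc.continuousAt
    refine ((hasDerivAt_exp_sq_half s).mul (h1.const_add _)).congr_deriv ?_
    have : Real.exp (s ^ 2 / 2) * Real.exp (-s ^ 2 / 2) = 1 := by
      rw [← Real.exp_add]; simp; ring
    simp only [hg]
    linear_combination K s * this
  · have e : ∀ s : ℝ, Real.exp (s ^ 2 / 2) * ((∫ s in Set.Iic 0, g s) + ∫ t in (0 : ℝ)..s, g t)
        * Real.exp (-s ^ 2 / 2) = (∫ s in Set.Iic 0, g s) + ∫ t in (0 : ℝ)..s, g t := by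
      intro s
      have : Real.exp (s ^ 2 / 2) * Real.exp (-s ^ 2 / 2) = 1 := by
        rw [← Real.exp_add]; simp; ring
      linear_combination ((∫ s in Set.Iic 0, g s) + ∫ t in (0 : ℝ)..s, g t) * this
    simp only [e]
    rw [cocompact_eq_atBot_atTop]
    refine Tendsto.sup ?_ ?_
    · have := (intervalIntegral_tendsto_integral_Iic 0 hgi.integrableOn tendsto_id).const_sub
        (∫ s in Set.Iic 0, g s)
      rw [sub_self] at this
      refine this.congr fun s => ?_
      simp only [id]
      rw [intervalIntegral.integral_symm 0 s]
      ring
    · have := (intervalIntegral_tendsto_integral_Ioi 0 hgi.integrableOn tendsto_id).const_add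
        (∫ s in Set.Iic 0, g s)
      rw [hsplit] at this
      exact this

/-! ### Taylor remainders along a segment -/

/-- Iterating this yields Taylor bounds with the factorial constants, without continuity or
integrability of the last derivative. -/
lemma abs_sub_le_of_deriv_pow {f f' : ℝ → ℝ} {c : ℝ} (k : ℕ) (hf : ∀ t, HasDerivAt f (f' t) t)
    (hb : ∀ t ∈ Set.Icc (0 : ℝ) 1, |f' t| ≤ c * t ^ k) {t : ℝ} (ht : t ∈ Set.Icc (0 : ℝ) 1) :
    |f t - f 0| ≤ c * t ^ (k + 1) / (k + 1) := by
  have hB : ∀ x, HasDerivAt (fun x : ℝ => c * x ^ (k + 1) / (k + 1)) (c * x ^ k) x := by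
    intro x
    have := ((hasDerivAt_pow (k + 1) x).const_mul c).div_const ((k : ℝ) + 1)
    refine this.congr_deriv ?_
    have : (k : ℝ) + 1 ≠ 0 := by positivity
    push_cast
    field_simp
  have := image_norm_le_of_norm_deriv_right_le_deriv_boundary (f := fun t => f t - f 0)
    (a := 0) (b := 1)
    (fun x _ => ((hf x).sub_const _).continuousAt.continuousWithinAt)
    (fun x _ => ((hf x).sub_const _).hasDerivWithinAt) (by simp) hB
    (fun x hx => by simpa using hb x ⟨hx.1, hx.2.le⟩) ht
  simpa using this

/-- The range of a quadratic weight along a segment. -/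
lemma quadratic_le_of_mem_segment {A B y x t : ℝ} (hB : 0 ≤ B) (ht : t ∈ Set.Icc (0 : ℝ) 1) :
    A + B * (y + t * x) ^ 2 ≤ A + B * (2 * y ^ 2 + 2 * x ^ 2) := by
  have h1 : (t * x) ^ 2 ≤ x ^ 2 := by
    rw [mul_pow]
    have : t ^ 2 ≤ 1 := pow_le_one₀ ht.1 ht.2
    nlinarith [sq_nonneg x]
  have h2 : (y + t * x) ^ 2 ≤ 2 * y ^ 2 + 2 * x ^ 2 := by nlinarith [sq_nonneg (y - t * x)]
  nlinarith [mul_le_mul_of_nonneg_left h2 hB]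

lemma hasDerivAt_comp_segment {F F1 : ℝ → ℝ} (h : ∀ s, HasDerivAt F (F1 s) s) (y x t : ℝ) :
    HasDerivAt (fun t => F (y + t * x)) (x * F1 (y + t * x)) t := by
  have h1 : HasDerivAt (fun t => y + t * x) x t := by
    simpa using ((hasDerivAt_id t).mul_const x).const_add y
  exact ((h (y + t * x)).scomp t h1)

section Taylor

variable {F F1 F2 F3 : ℝ → ℝ} {A B : ℝ}

lemma taylor_zero_bound (hB : 0 ≤ B) (h : ∀ s, HasDerivAt F (F1 s) s)
    (hb : ∀ s, |F1 s| ≤ A + B * s ^ 2) (y x : ℝ) {t : ℝ} (ht : t ∈ Set.Icc (0 : ℝ) 1) :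
    |F (y + t * x) - F y| ≤ |x| * (A + B * (2 * y ^ 2 + 2 * x ^ 2)) * t := by
  have := abs_sub_le_of_deriv_pow (c := |x| * (A + B * (2 * y ^ 2 + 2 * x ^ 2))) 0
    (hasDerivAt_comp_segment h y x) (fun t ht => ?_) ht
  · simpa using this
  · rw [abs_mul, pow_zero, mul_one]
    exact mul_le_mul_of_nonneg_left ((hb _).trans (quadratic_le_of_mem_segment hB ht))
      (abs_nonneg _)

lemma taylor_one_bound (hB : 0 ≤ B) (h : ∀ s, HasDerivAt F (F1 s) s)
    (h1 : ∀ s, HasDerivAt F1 (F2 s) s)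
    (hb : ∀ s, |F2 s| ≤ A + B * s ^ 2) (y x : ℝ) {t : ℝ} (ht : t ∈ Set.Icc (0 : ℝ) 1) :
    |F (y + t * x) - F y - t * x * F1 y|
      ≤ x ^ 2 * (A + B * (2 * y ^ 2 + 2 * x ^ 2)) * t ^ 2 / 2 := by
  have := abs_sub_le_of_deriv_pow (c := x ^ 2 * (A + B * (2 * y ^ 2 + 2 * x ^ 2))) 1
    (f := fun t => F (y + t * x) - t * x * F1 y) (f' := fun t => x * (F1 (y + t * x) - F1 y))
    (fun t => ?_) (fun t ht => ?_) ht
  · rw [show F (y + t * x) - F y - t * x * F1 y =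
      F (y + t * x) - t * x * F1 y - (F (y + 0 * x) - 0 * x * F1 y) by simp; ring]
    refine this.trans (le_of_eq ?_)
    norm_num
  · refine ((hasDerivAt_comp_segment h y x t).sub
      (((hasDerivAt_id t).mul_const x).mul_const (F1 y))).congr_deriv ?_
    ring
  · rw [abs_mul]
    refine (mul_le_mul_of_nonneg_left (taylor_zero_bound hB h1 hb y x ht)
      (abs_nonneg _)).trans (le_of_eq ?_)
    rw [← sq_abs x]; ring

lemma taylor_two_bound (hB : 0 ≤ B) (h : ∀ s, HasDerivAt F (F1 s) s)
    (h1 : ∀ s, HasDerivAt F1 (F2 s) s) (h2 : ∀ s, HasDerivAt F2 (F3 s) s)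
    (hb : ∀ s, |F3 s| ≤ A + B * s ^ 2) (y x : ℝ) {t : ℝ} (ht : t ∈ Set.Icc (0 : ℝ) 1) :
    |F (y + t * x) - F y - t * x * F1 y - (t * x) ^ 2 / 2 * F2 y|
      ≤ |x| ^ 3 * (A + B * (2 * y ^ 2 + 2 * x ^ 2)) * t ^ 3 / 6 := by
  have := abs_sub_le_of_deriv_pow (c := |x| ^ 3 * (A + B * (2 * y ^ 2 + 2 * x ^ 2)) / 2) 2
    (f := fun t => F (y + t * x) - t * x * F1 y - (t * x) ^ 2 / 2 * F2 y)
    (f' := fun t => x * (F1 (y + t * x) - F1 y - t * x * F2 y))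
    (fun t => ?_) (fun t ht => ?_) ht
  · rw [show F (y + t * x) - F y - t * x * F1 y - (t * x) ^ 2 / 2 * F2 y =
      F (y + t * x) - t * x * F1 y - (t * x) ^ 2 / 2 * F2 y
        - (F (y + 0 * x) - 0 * x * F1 y - (0 * x) ^ 2 / 2 * F2 y) by simp; ring]
    refine this.trans (le_of_eq ?_)
    norm_num
    ring
  · have e : HasDerivAt (fun t : ℝ => (t * x) ^ 2 / 2) (t * x * x) t := by
      refine ((((hasDerivAt_id t).mul_const x).pow 2).div_const 2).congr_deriv ?_
      simp
      ring
    refine (((hasDerivAt_comp_segment h y x t).sub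
      (((hasDerivAt_id t).mul_const x).mul_const (F1 y))).sub (e.mul_const (F2 y))).congr_deriv ?_
    ring
  · rw [abs_mul]
    refine (mul_le_mul_of_nonneg_left (taylor_one_bound hB h1 h2 hb y x ht)
      (abs_nonneg _)).trans (le_of_eq ?_)
    rw [← sq_abs x]; ring

end Taylor

/-! ### Bounds on the Stein solutions -/

lemma integral_sq_gaussianReal : ∫ z, z ^ 2 ∂(gaussianReal 0 1) = 1 := by
  have h := variance_fun_id_gaussianReal (μ := 0) (v := 1)
  rw [variance_of_integral_eq_zero (by fun_prop) (by simp)] at h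
  simpa using h

lemma integrable_sq_gaussianReal : Integrable (fun z : ℝ => z ^ 2) (gaussianReal 0 1) :=
  (memLp_id_gaussianReal (μ := 0) (v := 1) 2).integrable_sq

lemma integrable_gaussianReal_of_quadratic_bound {U : ℝ → ℝ} {c : ℝ} (hU : Continuous U)
    (h : ∀ s, |U s| ≤ c * (1 + s ^ 2)) : Integrable U (gaussianReal 0 1) :=
  (((integrable_const (1 : ℝ)).add integrable_sq_gaussianReal).const_mul c).mono'
    hU.aestronglyMeasurable (Eventually.of_forall h)

/-- A smooth function of the square of its argument. -/
structure IsSquareFunction (H H1 H2 : ℝ → ℝ) (a b : ℝ) : Prop where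
  hasDerivAt : ∀ s, HasDerivAt H (H1 s) s
  hasDerivAt_deriv : ∀ s, HasDerivAt H1 (H2 s) s
  even : ∀ s, H (-s) = H s
  odd : ∀ s, H1 (-s) = -H1 s
  abs_sub_le : ∀ s t, |H s - H t| ≤ a * (s ^ 2 + t ^ 2)
  abs_deriv_le : ∀ s, |H1 s| ≤ 2 * a * |s|
  abs_deriv_two_le : ∀ s, |H2 s| ≤ 2 * a + 4 * b * s ^ 2

lemma IsSquareFunction.integrable {H H1 H2 : ℝ → ℝ} {a b : ℝ} (hH : IsSquareFunction H H1 H2 a b) :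
    Integrable H (gaussianReal 0 1) := by
  have hc : Continuous H := continuous_iff_continuousAt.2 fun s => (hH.hasDerivAt s).continuousAt
  have ha : 0 ≤ a := by simpa using (abs_nonneg _).trans (hH.abs_sub_le 1 0)
  refine integrable_gaussianReal_of_quadratic_bound (c := |H 0| + a) hc fun s => ?_
  have h1 := hH.abs_sub_le s 0
  have h2 : |H s| ≤ |H s - H 0| + |H 0| := by
    have := abs_add_le (H s - H 0) (H 0)
    simpa using this
  have : 0 ≤ |H 0| * s ^ 2 := by positivity
  nlinarith

lemma IsSquareFunction.abs_sub_integral_le {H H1 H2 : ℝ → ℝ} {a b : ℝ}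
    (hH : IsSquareFunction H H1 H2 a b) (s : ℝ) :
    |H s - ∫ z, H z ∂(gaussianReal 0 1)| ≤ a * (1 + s ^ 2) := by
  have e : H s - ∫ z, H z ∂(gaussianReal 0 1) = ∫ z, (H s - H z) ∂(gaussianReal 0 1) := by
    rw [integral_sub (integrable_const _) hH.integrable]
    simp
  rw [e]
  have hi : Integrable (fun z : ℝ => a * (s ^ 2 + z ^ 2)) (gaussianReal 0 1) :=
    ((integrable_const _).add integrable_sq_gaussianReal).const_mul a
  refine (norm_integral_le_of_norm_le (f := fun z => H s - H z) hi
    (Eventually.of_forall fun z => hH.abs_sub_le s z)).trans (le_of_eq ?_)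
  rw [integral_const_mul, integral_add (integrable_const _) integrable_sq_gaussianReal,
    integral_sq_gaussianReal]
  simp
  ring_nf
  simp

lemma barrier_le {c C B : ℝ} (hc : 0 ≤ c) (s : ℝ) : c / (1 + |s|) + C + B * |s| ≤ c + C + B * |s| := by
  have := div_le_self hc (show 1 ≤ 1 + |s| by linarith [abs_nonneg s])
  linarith

/-- The decay `1 / (1 + |s|)` in the barrier keeps the product with `s` from acquiring a linear term
of size `c`. -/
lemma abs_mul_barrier_le {c B x s : ℝ} (hc : 0 ≤ c) (hx : |x| ≤ c / (1 + |s|) + 0 + B * |s|) :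
    |s * x| ≤ c + B * s ^ 2 := by
  rw [abs_mul]
  refine (mul_le_mul_of_nonneg_left hx (abs_nonneg s)).trans ?_
  have h1 : |s| * (c / (1 + |s|)) ≤ c := by
    rw [mul_div_assoc', div_le_iff₀ (by positivity)]
    nlinarith [abs_nonneg s]
  rw [← sq_abs s]
  nlinarith

lemma abs_le_one_add_sq (s : ℝ) : |s| ≤ 1 + s ^ 2 := by
  nlinarith [sq_abs s, sq_nonneg (|s| - 1)]

lemma quadratic_bound_of_linear {x p q s : ℝ} (hp : 0 ≤ p) (hq : 0 ≤ q) (h : |x| ≤ p + q * |s|) :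
    |x| ≤ (p + q) * (1 + s ^ 2) := by
  have h2 := mul_le_mul_of_nonneg_left (abs_le_one_add_sq s) hq
  have h3 : 0 ≤ p * s ^ 2 := by positivity
  nlinarith

/-- The derivatives of the solution of the Stein equation for a function of the square. -/
lemma exists_stein_chain {H H1 H2 : ℝ → ℝ} {a b : ℝ} (hb : 0 ≤ b)
    (hH : IsSquareFunction H H1 H2 a b) :
    ∃ (G G1 G2 G3 : ℝ → ℝ) (c : ℝ), (∀ s, HasDerivAt G (G1 s) s) ∧ (∀ s, HasDerivAt G1 (G2 s) s) ∧
      (∀ s, HasDerivAt G2 (G3 s) s) ∧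
      (∀ s, G1 s - s * G s = H s - ∫ z, H z ∂(gaussianReal 0 1)) ∧
      (∀ s, |G s| ≤ c * (1 + s ^ 2)) ∧ (∀ s, |G1 s| ≤ c * (1 + s ^ 2)) ∧
      (∀ s, |G2 s| ≤ 48 * a + 8 * b + 4 * b * |s|) ∧
      (∀ s, |G3 s| ≤ 72 * a + 8 * b + 8 * b * s ^ 2) ∧ ∀ s, G2 (-s) = -G2 s := by
  set e := ∫ z, H z ∂(gaussianReal 0 1) with he
  have ha : 0 ≤ a := by simpa using (abs_nonneg _).trans (hH.abs_sub_le 1 0)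
  have hHc : Continuous H := continuous_iff_continuousAt.2 fun s => (hH.hasDerivAt s).continuousAt
  have hK : ∀ s, |H s - e| ≤ a * (1 + s ^ 2) := hH.abs_sub_integral_le
  obtain ⟨G, hG, hGlim⟩ := exists_stein_solution (K := fun s => H s - e) (by fun_prop) hK
    (by rw [integral_sub hH.integrable (integrable_const _)]; simp [he])
  have hGodd : ∀ s, G (-s) = -G s := by
    intro s
    have hneg : Tendsto (fun s : ℝ => -s) (cocompact ℝ) (cocompact ℝ) :=
      (Homeomorph.neg ℝ).isClosedEmbedding.tendsto_cocompact
    -- `H` is even, so `G s + G (-s)` solves the homogeneous equation; with zero source the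
    -- comparison principle forces it to vanish.
    have := stein_abs_le (U := fun s => G s + G (-s)) (K := fun _ => 0) (A := 0) (B := 0) (C := 0)
      le_rfl le_rfl le_rfl (fun s => ?_) (by simp) ?_ s
    · simp only [add_zero, mul_zero, zero_div, zero_mul, abs_nonpos_iff] at this
      linarith
    · refine ((hG s).add ((hG (-s)).scomp s (hasDerivAt_neg s))).congr_deriv ?_
      simp only [smul_eq_mul, hH.even]; ring
    · have := hGlim.add (hGlim.comp hneg)
      simp only [add_zero, Function.comp_def, neg_sq] at this
      exact this.congr fun s => by ring
  have bG : ∀ s, |G s| ≤ 4 * a + a * |s| := by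
    intro s
    have := stein_abs_le (A := a) (B := a) (C := 0) ha ha le_rfl hG
      (fun s => (hK s).trans (by linarith)) hGlim s
    have h2 := barrier_le (c := 2 * (a + a)) (C := 0) (B := a) (by positivity) s
    linarith
  -- The Stein equation itself defines the derivative. Differentiating it shows that `G1` solves the
  -- equation with source `G + H1`, and then `G2` the one with source `2 * G1 + H2`.
  set G1 : ℝ → ℝ := fun s => s * G s + (H s - e) with hG1
  have dG1 : ∀ s, HasDerivAt G1 (s * G1 s + (G s + H1 s)) s := by
    intro s
    refine (((hasDerivAt_id s).mul (hG s)).add ((hH.hasDerivAt s).sub_const e)).congr_deriv ?_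
    simp only [id, hG1]; ring
  have qG1 : ∀ s, |G1 s| ≤ (6 * a) * (1 + s ^ 2) := by
    intro s
    refine (abs_add_le _ _).trans ?_
    rw [abs_mul]
    have h1 := mul_le_mul_of_nonneg_left (bG s) (abs_nonneg s)
    have h2 := mul_le_mul_of_nonneg_left (abs_le_one_add_sq s) ha
    have h3 := hK s
    have h4 : |s| * |s| = s ^ 2 := by rw [← sq, sq_abs]
    nlinarith
  have bG1 : ∀ s, |G1 s| ≤ 11 * a := by
    intro s
    have := stein_abs_le (A := 4 * a) (B := 0) (C := 3 * a) (by positivity) le_rfl (by positivity)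
      dG1 (fun s => (abs_add_le _ _).trans (by linarith [bG s, hH.abs_deriv_le s]))
      (tendsto_mul_exp_of_quadratic_bound qG1) s
    have h2 := barrier_le (c := 2 * (4 * a + 0)) (C := 3 * a) (B := 0) (by positivity) s
    linarith
  set G2 : ℝ → ℝ := fun s => s * G1 s + (G s + H1 s) with hG2
  have dG2 : ∀ s, HasDerivAt G2 (s * G2 s + (2 * G1 s + H2 s)) s := by
    intro s
    refine (((hasDerivAt_id s).mul (dG1 s)).add
      ((hG s).add (hH.hasDerivAt_deriv s))).congr_deriv ?_
    simp only [id, hG1, hG2]; ring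
  have bK2 : ∀ s, |2 * G1 s + H2 s| ≤ 24 * a + 4 * b * s ^ 2 := by
    intro s
    refine (abs_add_le _ _).trans ?_
    rw [abs_mul, abs_two]
    linarith [bG1 s, hH.abs_deriv_two_le s]
  have qG2 : ∀ s, |G2 s| ≤ (4 * a + 14 * a) * (1 + s ^ 2) := by
    intro s
    refine quadratic_bound_of_linear (by positivity) (by positivity) ?_
    have h1 := abs_add_le (s * G1 s) (G s + H1 s)
    have h2 := abs_add_le (G s) (H1 s)
    rw [abs_mul] at h1
    have h3 := mul_le_mul_of_nonneg_left (bG1 s) (abs_nonneg s)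
    simp only [hG2]
    linarith [bG s, hH.abs_deriv_le s]
  -- The decaying term is kept here because `G3` contains `s * G2 s`.
  have bG2 : ∀ s, |G2 s| ≤ 2 * (24 * a + 4 * b) / (1 + |s|) + 0 + 4 * b * |s| := fun s =>
    stein_abs_le (A := 24 * a) (B := 4 * b) (C := 0) (by positivity) (by positivity) le_rfl
      dG2 (fun s => by simpa using bK2 s) (tendsto_mul_exp_of_quadratic_bound qG2) s
  refine ⟨G, G1, G2, fun s => s * G2 s + (2 * G1 s + H2 s), 6 * a, hG, dG1, dG2,
    fun s => by simp only [hG1]; ring, fun s => ?_, qG1, fun s => ?_, fun s => ?_, fun s => ?_⟩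
  · refine (quadratic_bound_of_linear (by positivity) ha (bG s)).trans ?_
    have : 0 ≤ a * (1 + s ^ 2) := by positivity
    linarith
  · have := barrier_le (c := 2 * (24 * a + 4 * b)) (C := 0) (B := 4 * b) (by positivity) s
    linarith [bG2 s]
  · have h1 := abs_mul_barrier_le (by positivity) (bG2 s)
    have h2 := bK2 s
    have h3 := abs_add_le (s * G2 s) (2 * G1 s + H2 s)
    linarith
  · simp only [hG2, hG1, hGodd, hH.even, hH.odd]
    ring

/-- The solution of the Stein equation for an odd function of at most linear growth. -/
lemma exists_stein_chain_of_odd {k k1 : ℝ → ℝ} {p q r u : ℝ} (hp : 0 ≤ p) (hq : 0 ≤ q)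
    (hr : 0 ≤ r) (hu : 0 ≤ u)
    (hk : ∀ s, HasDerivAt k (k1 s) s) (hodd : ∀ s, k (-s) = -k s)
    (bk : ∀ s, |k s| ≤ p + q * |s|) (bk1 : ∀ s, |k1 s| ≤ r + u * s ^ 2) :
    ∃ (Q Q1 Q2 : ℝ → ℝ) (c : ℝ), (∀ s, HasDerivAt Q (Q1 s) s) ∧ (∀ s, HasDerivAt Q1 (Q2 s) s) ∧
      (∀ s, Q1 s - s * Q s = k s) ∧
      (∀ s, |Q s| ≤ c * (1 + s ^ 2)) ∧ (∀ s, |Q1 s| ≤ c * (1 + s ^ 2)) ∧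
      (∀ s, |Q2 s| ≤ 3 * (2 * p + q + r) + 2 * u + 2 * u * s ^ 2) := by
  have hkc : Continuous k := continuous_iff_continuousAt.2 fun s => (hk s).continuousAt
  -- Solvability: an odd function has mean zero under the symmetric Gaussian law.
  have hk0 : ∫ s, k s ∂(gaussianReal 0 1) = 0 := by
    have hmap : (gaussianReal 0 1).map (fun s => -s) = gaussianReal 0 1 := by
      rw [gaussianReal_map_neg]; simp
    have h1 : ∫ s, k s ∂(gaussianReal 0 1) = ∫ s, k (-s) ∂(gaussianReal 0 1) := by
      conv_lhs => rw [← hmap]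
      rw [integral_map (by fun_prop) hkc.aestronglyMeasurable]
    simp only [hodd, integral_neg] at h1
    linarith
  have qk : ∀ s, |k s| ≤ (p + q) * (1 + s ^ 2) := fun s => quadratic_bound_of_linear hp hq (bk s)
  obtain ⟨Q, hQ, hQlim⟩ := exists_stein_solution hkc qk hk0
  have bQ : ∀ s, |Q s| ≤ 2 * p + q := by
    intro s
    have := stein_abs_le (A := p) (B := 0) (C := q) hp le_rfl hq hQ
      (fun s => (bk s).trans (by linarith)) hQlim s
    have h2 := barrier_le (c := 2 * (p + 0)) (C := q) (B := 0) (by positivity) s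
    linarith
  set Q1 : ℝ → ℝ := fun s => s * Q s + k s with hQ1
  have dQ1 : ∀ s, HasDerivAt Q1 (s * Q1 s + (Q s + k1 s)) s := by
    intro s
    refine (((hasDerivAt_id s).mul (hQ s)).add (hk s)).congr_deriv ?_
    simp only [id, hQ1]; ring
  have qQ1 : ∀ s, |Q1 s| ≤ (p + (2 * p + q + q)) * (1 + s ^ 2) := by
    intro s
    refine quadratic_bound_of_linear hp (by positivity) ?_
    have h1 := abs_add_le (s * Q s) (k s)
    rw [abs_mul] at h1
    have h3 := mul_le_mul_of_nonneg_left (bQ s) (abs_nonneg s)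
    simp only [hQ1]
    linarith [bk s]
  have bK : ∀ s, |Q s + k1 s| ≤ (2 * p + q + r) + u * s ^ 2 := fun s =>
    (abs_add_le _ _).trans (by linarith [bQ s, bk1 s])
  have bQ1 : ∀ s, |Q1 s| ≤ 2 * ((2 * p + q + r) + u) / (1 + |s|) + 0 + u * |s| := fun s =>
    stein_abs_le (A := 2 * p + q + r) (B := u) (C := 0) (by positivity) hu le_rfl
      dQ1 (fun s => by simpa using bK s) (tendsto_mul_exp_of_quadratic_bound qQ1) s
  refine ⟨Q, Q1, fun s => s * Q1 s + (Q s + k1 s), p + (2 * p + q + q), hQ, dQ1,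
    fun s => by simp only [hQ1]; ring, fun s => ?_, qQ1, fun s => ?_⟩
  · have := bQ s
    have h0 : 0 ≤ (p + (2 * p + q + q)) * s ^ 2 := by positivity
    linarith
  · have h1 := abs_mul_barrier_le (by positivity) (bQ1 s)
    have h3 := abs_add_le (s * Q1 s) (Q s + k1 s)
    linarith [bK s]

/-! ### Expansion in one independent summand -/

/-- The function `f` is integrable with integral `a`. -/
def HasMean {Ω : Type*} [MeasurableSpace Ω] (μ : Measure Ω) (f : Ω → ℝ) (a : ℝ) : Prop :=
  Integrable f μ ∧ ∫ ω, f ω ∂μ = a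

namespace HasMean

variable {Ω : Type*} [MeasurableSpace Ω] {μ : Measure Ω} {f g : Ω → ℝ} {a b : ℝ}

lemma add (hf : HasMean μ f a) (hg : HasMean μ g b) : HasMean μ (fun ω => f ω + g ω) (a + b) :=
  ⟨hf.1.add hg.1, by rw [integral_add hf.1 hg.1, hf.2, hg.2]⟩

lemma sub (hf : HasMean μ f a) (hg : HasMean μ g b) : HasMean μ (fun ω => f ω - g ω) (a - b) :=
  ⟨hf.1.sub hg.1, by rw [integral_sub hf.1 hg.1, hf.2, hg.2]⟩

lemma const_mul (c : ℝ) (hf : HasMean μ f a) : HasMean μ (fun ω => c * f ω) (c * a) :=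
  ⟨hf.1.const_mul c, by rw [integral_const_mul, hf.2]⟩

/-- An integrable error bound carries over to the means. -/
lemma of_abs_sub_le {r : ℝ} {d e : Ω → ℝ} (hg : HasMean μ g b) (he : HasMean μ e r)
    (hd : AEStronglyMeasurable d μ) (h : ∀ ω, |d ω - g ω| ≤ e ω) :
    Integrable d μ ∧ |∫ ω, d ω ∂μ - b| ≤ r := by
  have h1 : Integrable (fun ω => d ω - g ω) μ :=
    he.1.mono' (hd.sub hg.1.aestronglyMeasurable) (Eventually.of_forall h)
  have hdi : Integrable d μ := by
    refine (h1.add hg.1).congr (Eventually.of_forall fun ω => ?_)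
    simp
  refine ⟨hdi, ?_⟩
  rw [← hg.2, ← he.2, ← integral_sub hdi hg.1]
  exact norm_integral_le_of_norm_le (f := fun ω => d ω - g ω) he.1 (Eventually.of_forall h)

end HasMean

lemma ProbabilityTheory.IndepFun.hasMean_mul {Ω : Type*} [MeasurableSpace Ω] {μ : Measure Ω}
    {X Y : Ω → ℝ} {f g : ℝ → ℝ} (h : IndepFun X Y μ) (hf : Continuous f) (hg : Continuous g)
    (hX : AEMeasurable X μ) (hY : AEMeasurable Y μ)
    (hfX : Integrable (fun ω => f (X ω)) μ) (hgY : Integrable (fun ω => g (Y ω)) μ) :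
    HasMean μ (fun ω => f (X ω) * g (Y ω)) ((∫ ω, f (X ω) ∂μ) * ∫ ω, g (Y ω) ∂μ) :=
  ⟨(h.comp hf.measurable hg.measurable).integrable_mul hfX hgY,
    h.integral_fun_comp_mul_comp hX hY hf.aestronglyMeasurable hg.aestronglyMeasurable⟩

lemma MeasureTheory.MemLp.integrable_abs_pow_of_le {Ω : Type*} [MeasurableSpace Ω] {μ : Measure Ω}
    [IsFiniteMeasure μ] {f : Ω → ℝ} {p : ℕ} (hf : MemLp f p μ) {k : ℕ} (hk : k ≤ p) :
    Integrable (fun ω => |f ω| ^ k) μ :=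
  (hf.mono_exponent (by exact_mod_cast hk)).integrable_norm_pow'

lemma MeasureTheory.MemLp.integrable_pow_of_le {Ω : Type*} [MeasurableSpace Ω] {μ : Measure Ω}
    [IsFiniteMeasure μ] {f : Ω → ℝ} {p : ℕ} (hf : MemLp f p μ) {k : ℕ} (hk : k ≤ p) :
    Integrable (fun ω => f ω ^ k) μ :=
  (hf.integrable_abs_pow_of_le hk).mono (hf.1.pow k) (Eventually.of_forall fun ω => by simp)

/-- A small centred summand `ξ` and an independent remainder `Y`, with the normalised moment bounds
that hold for a sum of independent copies of a standardised variable. -/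
structure IsStandardSplitting {Ω : Type*} [MeasurableSpace Ω] (μ : Measure Ω) (Y ξ : Ω → ℝ)
    (d m γ : ℝ) : Prop where
  indep : IndepFun ξ Y μ
  memLp_left : MemLp Y (8 : ℕ) μ
  memLp_right : MemLp ξ (8 : ℕ) μ
  mean : ∫ ω, ξ ω ∂μ = 0
  sq : ∫ ω, ξ ω ^ 2 ∂μ = d ^ 2
  cube : ∫ ω, ξ ω ^ 3 ∂μ = d ^ 3 * γ
  sq_left : ∫ ω, Y ω ^ 2 ∂μ ≤ 1
  abs_pow : ∀ k, 1 ≤ k → k ≤ 8 → ∫ ω, |ξ ω| ^ k ∂μ ≤ d ^ k * m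

namespace IsStandardSplitting

variable {Ω : Type*} [MeasurableSpace Ω] {μ : Measure Ω} {Y ξ : Ω → ℝ} {d m γ : ℝ}

lemma aestronglyMeasurable_comp_add (h : IsStandardSplitting μ Y ξ d m γ) {φ : ℝ → ℝ}
    (hφ : Continuous φ) : AEStronglyMeasurable (fun ω => φ (Y ω + ξ ω)) μ :=
  hφ.comp_aestronglyMeasurable (h.memLp_left.1.add h.memLp_right.1)

variable [IsProbabilityMeasure μ]

lemma integrable_comp (h : IsStandardSplitting μ Y ξ d m γ) {φ : ℝ → ℝ} {c : ℝ}
    (hφ : Continuous φ) (hb : ∀ s, |φ s| ≤ c * (1 + s ^ 2)) :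
    Integrable (fun ω => φ (Y ω)) μ :=
  (((integrable_const (1 : ℝ)).add
    (h.memLp_left.integrable_pow_of_le (k := 2) (by norm_num))).const_mul c).mono'
    (hφ.comp_aestronglyMeasurable h.memLp_left.1) (Eventually.of_forall fun ω => hb (Y ω))

lemma hasMean_mul (h : IsStandardSplitting μ Y ξ d m γ) {φ : ℝ → ℝ} {c : ℝ}
    (hφ : Continuous φ) (hb : ∀ s, |φ s| ≤ c * (1 + s ^ 2)) {k : ℕ} (hk : k ≤ 8) :
    HasMean μ (fun ω => ξ ω ^ k * φ (Y ω)) ((∫ ω, ξ ω ^ k ∂μ) * ∫ ω, φ (Y ω) ∂μ) :=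
  h.indep.hasMean_mul (f := fun x => x ^ k) (by fun_prop) hφ h.memLp_right.1.aemeasurable
    h.memLp_left.1.aemeasurable (h.memLp_right.integrable_pow_of_le hk) (h.integrable_comp hφ hb)

lemma hasMean_comp (h : IsStandardSplitting μ Y ξ d m γ) {φ : ℝ → ℝ} {c : ℝ}
    (hφ : Continuous φ) (hb : ∀ s, |φ s| ≤ c * (1 + s ^ 2)) :
    HasMean μ (fun ω => φ (Y ω)) (∫ ω, φ (Y ω) ∂μ) := ⟨h.integrable_comp hφ hb, rfl⟩

/-- This integrates the Taylor remainder weight. The factor `A + 4 * B` collects `2 * B` from `E Y ^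
2 ≤ 1` and `2 * B` from the moment of order `k + 2`, where `d ^ (k + 2) ≤ d ^ k`. -/
lemma hasMean_weight (h : IsStandardSplitting μ Y ξ d m γ) (hd : 0 ≤ d) (hd1 : d ≤ 1) (hm : 0 ≤ m)
    {A B : ℝ} (hA : 0 ≤ A) (hB : 0 ≤ B) {k : ℕ} (h1 : 1 ≤ k) (hk : k + 2 ≤ 8) :
    ∃ w, HasMean μ (fun ω => |ξ ω| ^ k * (A + B * (2 * Y ω ^ 2 + 2 * ξ ω ^ 2))) w ∧
      w ≤ d ^ k * m * (A + 4 * B) := by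
  have hY := h.memLp_left.integrable_pow_of_le (k := 2) (by norm_num)
  have e1 := h.indep.hasMean_mul (f := fun x => |x| ^ k) (g := fun y => A + 2 * B * y ^ 2)
    (by fun_prop) (by fun_prop) h.memLp_right.1.aemeasurable
    h.memLp_left.1.aemeasurable (h.memLp_right.integrable_abs_pow_of_le (by omega))
    ((integrable_const A).add (hY.const_mul (2 * B)))
  have e2 : HasMean μ (fun ω => |ξ ω| ^ (k + 2)) (∫ ω, |ξ ω| ^ (k + 2) ∂μ) :=
    ⟨h.memLp_right.integrable_abs_pow_of_le hk, rfl⟩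
  have e3 := e1.add (e2.const_mul (2 * B))
  refine ⟨_, ⟨e3.1.congr (Eventually.of_forall fun ω => ?_), (integral_congr_ae
    (Eventually.of_forall fun ω => ?_)).trans e3.2⟩, ?_⟩
  · simp only [pow_add, sq_abs]; ring
  · simp only [pow_add, sq_abs]; ring
  · have i1 : ∫ ω, (A + 2 * B * Y ω ^ 2) ∂μ ≤ A + 2 * B := by
      rw [integral_add (integrable_const A) (hY.const_mul (2 * B)), integral_const_mul]
      have := mul_le_mul_of_nonneg_left h.sq_left hB
      simp
      linarith
    have i0 : 0 ≤ ∫ ω, (A + 2 * B * Y ω ^ 2) ∂μ := integral_nonneg fun ω => by positivity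
    have i2 := h.abs_pow k h1 (by omega)
    have i3 : ∫ ω, |ξ ω| ^ (k + 2) ∂μ ≤ d ^ k * m :=
      (h.abs_pow (k + 2) (by omega) hk).trans
        (mul_le_mul_of_nonneg_right (pow_le_pow_of_le_one hd hd1 (by omega)) hm)
    have i4 := mul_le_mul i2 i1 i0 (by positivity)
    have i5 := mul_le_mul_of_nonneg_left i3 hB
    linarith

variable {F F1 F2 F3 : ℝ → ℝ} {A B c : ℝ}

/-- Transfers the estimate for `G''(S)` to `G''(Y)`. -/
lemma shift_bound (h : IsStandardSplitting μ Y ξ d m γ) (hd : 0 ≤ d) (hd1 : d ≤ 1) (hm : 0 ≤ m)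
    (hA : 0 ≤ A) (hB : 0 ≤ B) (hF : ∀ s, HasDerivAt F (F1 s) s)
    (hFb : ∀ s, |F s| ≤ c * (1 + s ^ 2)) (hb : ∀ s, |F1 s| ≤ A + B * s ^ 2) :
    |∫ ω, F (Y ω + ξ ω) ∂μ - ∫ ω, F (Y ω) ∂μ| ≤ d * m * (A + 4 * B) := by
  have hFc : Continuous F := continuous_iff_continuousAt.2 fun s => (hF s).continuousAt
  obtain ⟨w, hw, hw'⟩ := h.hasMean_weight hd hd1 hm hA hB (k := 1) le_rfl (by norm_num)
  have := (h.hasMean_comp hFc hFb).of_abs_sub_le hw (h.aestronglyMeasurable_comp_add hFc)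
    (fun ω => by
      simpa using taylor_zero_bound hB hF hb (Y ω) (ξ ω) (t := 1) (by simp))
  rw [pow_one] at hw'
  exact this.2.trans hw'

/-- In the expansion of `ξ F(Y + ξ)` the term `ξ F(Y)` has mean zero and `ξ ^ 2 F'(Y)` has mean `d ^
2 E F'(Y)`, cancelling the other half of the Stein operator. The remainders contribute `1 + 1 / 2`.
-/
lemma stein_first_order (h : IsStandardSplitting μ Y ξ d m γ) (hd : 0 ≤ d) (hd1 : d ≤ 1)
    (hm : 0 ≤ m) (hA : 0 ≤ A) (hB : 0 ≤ B) (hF : ∀ s, HasDerivAt F (F1 s) s)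
    (hF1 : ∀ s, HasDerivAt F1 (F2 s) s) (hFb : ∀ s, |F s| ≤ c * (1 + s ^ 2))
    (hF1b : ∀ s, |F1 s| ≤ c * (1 + s ^ 2)) (hb : ∀ s, |F2 s| ≤ A + B * s ^ 2) :
    Integrable (fun ω => d ^ 2 * F1 (Y ω + ξ ω) - ξ ω * F (Y ω + ξ ω)) μ ∧
    |∫ ω, (d ^ 2 * F1 (Y ω + ξ ω) - ξ ω * F (Y ω + ξ ω)) ∂μ|
      ≤ d ^ 3 * m * (3 / 2 * (A + 4 * B)) := by
  have hFc : Continuous F := continuous_iff_continuousAt.2 fun s => (hF s).continuousAt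
  have hF1c : Continuous F1 := continuous_iff_continuousAt.2 fun s => (hF1 s).continuousAt
  obtain ⟨w1, hw1, hw1'⟩ := h.hasMean_weight hd hd1 hm hA hB (k := 1) le_rfl (by norm_num)
  obtain ⟨w3, hw3, hw3'⟩ := h.hasMean_weight hd hd1 hm hA hB (k := 3) (by norm_num) (by norm_num)
  have hP := (((h.hasMean_comp hF1c hF1b).const_mul (d ^ 2)).sub
    (h.hasMean_mul hFc hFb (k := 1) (by norm_num))).sub
    (h.hasMean_mul hF1c hF1b (k := 2) (by norm_num))
  have hR := (hw1.const_mul (d ^ 2)).add (hw3.const_mul (1 / 2))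
  have := hP.of_abs_sub_le hR
    (d := fun ω => d ^ 2 * F1 (Y ω + ξ ω) - ξ ω * F (Y ω + ξ ω))
    (((h.aestronglyMeasurable_comp_add hF1c).const_mul _).sub
      (h.memLp_right.1.mul (h.aestronglyMeasurable_comp_add hFc))) (fun ω => ?_)
  · refine ⟨this.1, ?_⟩
    have h2 := this.2
    simp only [pow_one, h.mean, h.sq] at h2
    rw [zero_mul, sub_zero, sub_self, sub_zero] at h2
    refine h2.trans ?_
    have := mul_le_mul_of_nonneg_left hw1' (sq_nonneg d)
    nlinarith
  · have t0 := taylor_zero_bound hB hF1 hb (Y ω) (ξ ω) (t := 1) (by simp)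
    have t1 := taylor_one_bound hB hF hF1 hb (Y ω) (ξ ω) (t := 1) (by simp)
    simp only [one_mul, one_pow, mul_one] at t0 t1
    rw [show d ^ 2 * F1 (Y ω + ξ ω) - ξ ω * F (Y ω + ξ ω) - (d ^ 2 * F1 (Y ω) - ξ ω ^ 1 * F (Y ω)
      - ξ ω ^ 2 * F1 (Y ω)) = d ^ 2 * (F1 (Y ω + ξ ω) - F1 (Y ω))
      - ξ ω * (F (Y ω + ξ ω) - F (Y ω) - ξ ω * F1 (Y ω)) by ring]
    refine (abs_sub _ _).trans ?_
    rw [abs_mul, abs_mul, abs_of_nonneg (sq_nonneg d)]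
    refine (add_le_add (mul_le_mul_of_nonneg_left t0 (sq_nonneg d))
      (mul_le_mul_of_nonneg_left t1 (abs_nonneg _))).trans (le_of_eq ?_)
    have : |ξ ω| ^ 3 = |ξ ω| * ξ ω ^ 2 := by rw [← sq_abs (ξ ω)]; ring
    rw [this]
    ring

/-- With one more derivative only the third-moment term survives; it is kept explicitly because
oddness will make it small. The remainders contribute `1 / 2 + 1 / 6`. -/
lemma stein_second_order (h : IsStandardSplitting μ Y ξ d m γ) (hd : 0 ≤ d) (hd1 : d ≤ 1)
    (hm : 0 ≤ m) (hA : 0 ≤ A) (hB : 0 ≤ B) (hF : ∀ s, HasDerivAt F (F1 s) s)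
    (hF1 : ∀ s, HasDerivAt F1 (F2 s) s) (hF2 : ∀ s, HasDerivAt F2 (F3 s) s) {c' : ℝ}
    (hFb : ∀ s, |F s| ≤ c * (1 + s ^ 2)) (hF1b : ∀ s, |F1 s| ≤ c * (1 + s ^ 2))
    (hF2b : ∀ s, |F2 s| ≤ c' * (1 + s ^ 2)) (hb : ∀ s, |F3 s| ≤ A + B * s ^ 2) :
    Integrable (fun ω => d ^ 2 * F1 (Y ω + ξ ω) - ξ ω * F (Y ω + ξ ω)) μ ∧
    |∫ ω, (d ^ 2 * F1 (Y ω + ξ ω) - ξ ω * F (Y ω + ξ ω)) ∂μ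
        + 1 / 2 * (d ^ 3 * γ) * ∫ ω, F2 (Y ω) ∂μ|
      ≤ d ^ 4 * m * (2 / 3 * (A + 4 * B)) := by
  have hFc : Continuous F := continuous_iff_continuousAt.2 fun s => (hF s).continuousAt
  have hF1c : Continuous F1 := continuous_iff_continuousAt.2 fun s => (hF1 s).continuousAt
  have hF2c : Continuous F2 := continuous_iff_continuousAt.2 fun s => (hF2 s).continuousAt
  obtain ⟨w2, hw2, hw2'⟩ := h.hasMean_weight hd hd1 hm hA hB (k := 2) (by norm_num) (by norm_num)
  obtain ⟨w4, hw4, hw4'⟩ := h.hasMean_weight hd hd1 hm hA hB (k := 4) (by norm_num) (by norm_num)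
  -- The Taylor polynomial in `ξ`, whose mean factorizes by independence.
  have hP := (((((h.hasMean_comp hF1c hF1b).const_mul (d ^ 2)).add
    ((h.hasMean_mul hF2c hF2b (k := 1) (by norm_num)).const_mul (d ^ 2))).sub
    (h.hasMean_mul hFc hFb (k := 1) (by norm_num))).sub
    (h.hasMean_mul hF1c hF1b (k := 2) (by norm_num))).sub
    ((h.hasMean_mul hF2c hF2b (k := 3) (by norm_num)).const_mul (1 / 2))
  have hR := (hw2.const_mul (d ^ 2 / 2)).add (hw4.const_mul (1 / 6))
  have := hP.of_abs_sub_le hR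
    (d := fun ω => d ^ 2 * F1 (Y ω + ξ ω) - ξ ω * F (Y ω + ξ ω))
    (((h.aestronglyMeasurable_comp_add hF1c).const_mul _).sub
      (h.memLp_right.1.mul (h.aestronglyMeasurable_comp_add hFc))) (fun ω => ?_)
  · refine ⟨this.1, ?_⟩
    have h2 := this.2
    simp only [pow_one, h.mean, h.sq, h.cube] at h2
    refine (le_of_eq ?_).trans (h2.trans ?_)
    · congr 1; ring
    · have := mul_le_mul_of_nonneg_left hw2' (sq_nonneg d)
      nlinarith
  · have t1 := taylor_one_bound hB hF1 hF2 hb (Y ω) (ξ ω) (t := 1) (by simp)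
    have t2 := taylor_two_bound hB hF hF1 hF2 hb (Y ω) (ξ ω) (t := 1) (by simp)
    simp only [one_mul, one_pow, mul_one] at t1 t2
    have e : d ^ 2 * F1 (Y ω + ξ ω) - ξ ω * F (Y ω + ξ ω) - (d ^ 2 * F1 (Y ω)
      + d ^ 2 * (ξ ω ^ 1 * F2 (Y ω)) - ξ ω ^ 1 * F (Y ω) - ξ ω ^ 2 * F1 (Y ω)
      - 1 / 2 * (ξ ω ^ 3 * F2 (Y ω))) = d ^ 2 * (F1 (Y ω + ξ ω) - F1 (Y ω) - ξ ω * F2 (Y ω))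
      - ξ ω * (F (Y ω + ξ ω) - F (Y ω) - ξ ω * F1 (Y ω) - ξ ω ^ 2 / 2 * F2 (Y ω)) := by ring
    rw [e]
    refine (abs_sub _ _).trans ?_
    rw [abs_mul, abs_mul, abs_of_nonneg (sq_nonneg d)]
    refine (add_le_add (mul_le_mul_of_nonneg_left t1 (sq_nonneg d))
      (mul_le_mul_of_nonneg_left t2 (abs_nonneg _))).trans (le_of_eq ?_)
    rw [sq_abs]
    ring

end IsStandardSplitting

/-! ### Summation over the summands -/

/-- Normal approximation of order `d ^ 2 = 1 / n` for functions of the square. -/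
theorem abs_integral_sub_integral_gaussianReal_le {Ω : Type*} [MeasurableSpace Ω] {μ : Measure Ω}
    [IsProbabilityMeasure μ] {n : ℕ} {Y ξ : Fin n → Ω → ℝ} {S : Ω → ℝ} {d m γ : ℝ}
    (h : ∀ i, IsStandardSplitting μ (Y i) (ξ i) d m γ) (hS : ∀ i ω, S ω = Y i ω + ξ i ω)
    (hsum : ∀ ω, S ω = ∑ i, ξ i ω) (hd : 0 ≤ d) (hd1 : d ≤ 1) (hn : n * d ^ 2 = 1) (hm : 0 ≤ m)
    {H H1 H2 : ℝ → ℝ} {a b : ℝ} (hb : 0 ≤ b) (hH : IsSquareFunction H H1 H2 a b) :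
    |∫ ω, H (S ω) ∂μ - ∫ z, H z ∂(gaussianReal 0 1)|
      ≤ d ^ 2 * m * (48 * a + 80 / 3 * b + |γ| * (414 * a + 143 * b)) := by
  have ha : 0 ≤ a := by simpa using (abs_nonneg _).trans (hH.abs_sub_le 1 0)
  obtain ⟨G, G1, G2, G3, c, dG, dG1, dG2, hG, bG, bG1, bG2, bG3, G2odd⟩ := exists_stein_chain hb hH
  -- `G2` is odd, so it can serve as the source of a second Stein equation; the parameters are its
  -- bounds from the first chain.
  obtain ⟨Q, Q1, Q2, c', dQ, dQ1, hQ, bQ, bQ1, bQ2⟩ := exists_stein_chain_of_odd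
    (p := 48 * a + 8 * b) (q := 4 * b) (r := 72 * a + 8 * b) (u := 8 * b)
    (by positivity) (by positivity) (by positivity) (by positivity) dG2 G2odd bG2 bG3
  have bG2' : ∀ s, |G2 s| ≤ (48 * a + 8 * b + 4 * b) * (1 + s ^ 2) := fun s =>
    quadratic_bound_of_linear (by positivity) (by positivity) (bG2 s)
  set e := ∫ z, H z ∂(gaussianReal 0 1)
  -- decomposition of the Stein operator over the summands
  have decomp : ∀ (F F1 : ℝ → ℝ) (ω : Ω), F1 (S ω) - S ω * F (S ω)
      = ∑ i, (d ^ 2 * F1 (Y i ω + ξ i ω) - ξ i ω * F (Y i ω + ξ i ω)) := by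
    intro F F1 ω
    simp only [← hS, Finset.sum_sub_distrib, ← Finset.sum_mul, ← hsum]
    simp only [Finset.sum_const, Finset.card_univ, Fintype.card_fin, nsmul_eq_mul]
    linear_combination -F1 (S ω) * hn
  -- the mean of the second derivative is small
  have hG2S : |∫ ω, G2 (S ω) ∂μ| ≤ d * m * (3 / 2 * (504 * a + 164 * b)) := by
    have key := fun i => (h i).stein_first_order hd hd1 hm
      (A := 3 * (2 * (48 * a + 8 * b) + 4 * b + (72 * a + 8 * b)) + 2 * (8 * b)) (B := 2 * (8 * b))
      (by positivity) (by positivity) dQ dQ1 bQ bQ1 bQ2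
    have e1 : ∫ ω, G2 (S ω) ∂μ
        = ∑ i, ∫ ω, (d ^ 2 * Q1 (Y i ω + ξ i ω) - ξ i ω * Q (Y i ω + ξ i ω)) ∂μ := by
      rw [← integral_finsetSum _ fun i _ => (key i).1]
      refine integral_congr_ae (Eventually.of_forall fun ω => ?_)
      simp only [← decomp, hQ]
    rw [e1]
    refine (Finset.abs_sum_le_sum_abs _ _).trans
      ((Finset.sum_le_sum fun i _ => (key i).2).trans (le_of_eq ?_))
    simp only [Finset.sum_const, Finset.card_univ, Fintype.card_fin, nsmul_eq_mul]
    linear_combination (d * m * (3 / 2 * (504 * a + 164 * b))) * hn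
  -- The bound for `S`, `756 * a + 246 * b`, plus the shift `72 * a + 40 * b`.
  have hG2Y : ∀ i, |∫ ω, G2 (Y i ω) ∂μ|
      ≤ d * m * (828 * a + 286 * b) := by
    intro i
    have h1 := (h i).shift_bound hd hd1 hm (A := 72 * a + 8 * b) (B := 8 * b) (by positivity)
      (by positivity) dG2 bG2' bG3
    simp only [← hS] at h1
    rw [abs_le] at h1 hG2S ⊢
    constructor <;> linarith [h1.1, h1.2, hG2S.1, hG2S.2]
  have key := fun i => (h i).stein_second_order hd hd1 hm (A := 72 * a + 8 * b) (B := 8 * b)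
    (by positivity) (by positivity) dG dG1 dG2 bG bG1 bG2' bG3
  have key' : ∀ i, |∫ ω, (d ^ 2 * G1 (Y i ω + ξ i ω) - ξ i ω * G (Y i ω + ξ i ω)) ∂μ|
      ≤ d ^ 4 * m * (48 * a + 80 / 3 * b + |γ| * (414 * a + 143 * b)) := by
    intro i
    have h1 := (key i).2
    have h2 : |1 / 2 * (d ^ 3 * γ) * ∫ ω, G2 (Y i ω) ∂μ|
        ≤ 1 / 2 * (d ^ 3 * |γ|) * (d * m * (828 * a + 286 * b)) := by
      rw [abs_mul, abs_mul, abs_mul, abs_of_nonneg (pow_nonneg hd 3),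
        abs_of_nonneg (by norm_num : (0 : ℝ) ≤ 1 / 2)]
      exact mul_le_mul_of_nonneg_left (hG2Y i) (by positivity)
    have h3 := (abs_add_le _ (-(1 / 2 * (d ^ 3 * γ) * ∫ ω, G2 (Y i ω) ∂μ))).trans
      (add_le_add h1 ((abs_neg _).le.trans h2))
    rw [add_neg_cancel_right] at h3
    refine h3.trans (le_of_eq ?_)
    ring
  have hHe : ∀ ω, H (S ω) - e
      = ∑ i, (d ^ 2 * G1 (Y i ω + ξ i ω) - ξ i ω * G (Y i ω + ξ i ω)) := fun ω => by
    rw [← decomp, hG]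
  have hint : Integrable (fun ω => H (S ω)) μ := by
    refine ((integrable_finsetSum Finset.univ fun i _ => (key i).1).add
      (integrable_const e)).congr (Eventually.of_forall fun ω => ?_)
    simp only [Pi.add_apply, ← hHe, sub_add_cancel]
  have e2 : ∫ ω, H (S ω) ∂μ - e
      = ∑ i, ∫ ω, (d ^ 2 * G1 (Y i ω + ξ i ω) - ξ i ω * G (Y i ω + ξ i ω)) ∂μ := by
    rw [← integral_finsetSum _ fun i _ => (key i).1]
    simp only [← hHe]
    rw [integral_sub hint (integrable_const _)]
    simp
  rw [e2]
  refine (Finset.abs_sum_le_sum_abs _ _).trans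
    ((Finset.sum_le_sum fun i _ => key' i).trans (le_of_eq ?_))
  simp only [Finset.sum_const, Finset.card_univ, Fintype.card_fin, nsmul_eq_mul]
  linear_combination
    (d ^ 2 * m * (48 * a + 80 / 3 * b + |γ| * (414 * a + 143 * b))) * hn

/-! ### Moments of the summands and of their sum -/

/-- Weighted arithmetic-geometric mean inequality between `t ^ 2` and `t ^ 8`; after removing `t ^
2`, each exponent has an explicit sum-of-squares type certificate. -/
lemma pow_le_interpolation {t : ℝ} (ht : 0 ≤ t) {k : ℕ} (h2 : 2 ≤ k) (h8 : k ≤ 8) :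
    6 * t ^ k ≤ (8 - k) * t ^ 2 + (k - 2) * t ^ 8 := by
  obtain ⟨s, rfl⟩ := Nat.exists_eq_add_of_le h2
  have key : 6 * t ^ s ≤ (6 - s) + s * t ^ 6 := by
    have hs : s ≤ 6 := by omega
    interval_cases s
    · norm_num
    · have : 0 ≤ (t - 1) ^ 2 * (t ^ 4 + 2 * t ^ 3 + 3 * t ^ 2 + 4 * t + 5) := by positivity
      push_cast; linarith
    · have : 0 ≤ (t ^ 2 - 1) ^ 2 * (t ^ 2 + 2) := by positivity
      push_cast; linarith
    · have : 0 ≤ (t ^ 3 - 1) ^ 2 := by positivity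
      push_cast; linarith
    · have : 0 ≤ (t ^ 2 - 1) ^ 2 * (2 * t ^ 2 + 1) := by positivity
      push_cast; linarith
    · have : 0 ≤ (t - 1) ^ 2 * (5 * t ^ 4 + 4 * t ^ 3 + 3 * t ^ 2 + 2 * t + 1) := by positivity
      push_cast; linarith
    · norm_num
  have := mul_le_mul_of_nonneg_left key (sq_nonneg t)
  push_cast
  rw [pow_add]
  linarith

section Moments

variable {Ω : Type*} [MeasurableSpace Ω] {μ : Measure Ω} [IsProbabilityMeasure μ] {X : Ω → ℝ}

lemma one_le_integral_pow_eight (hX : MemLp X (8 : ℕ) μ) (hvar : ∫ ω, X ω ^ 2 ∂μ = 1) :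
    1 ≤ ∫ ω, X ω ^ 8 ∂μ := by
  have h2 := hX.integrable_pow_of_le (k := 2) (by norm_num)
  -- The tangent to `u ^ 4` at `u = 1`, with `u = X ^ 2`.
  have h := integral_mono (μ := μ) (f := fun ω => 4 * X ω ^ 2 - 3) (g := fun ω => X ω ^ 8)
    ((h2.const_mul 4).sub (integrable_const _)) (hX.integrable_pow_of_le le_rfl) (fun ω => by
      have : 0 ≤ (X ω ^ 2 - 1) ^ 2 * ((X ω ^ 2 + 1) ^ 2 + 2) := by positivity
      simp only
      linarith)
  rw [integral_sub (h2.const_mul 4) (integrable_const _), integral_const_mul, hvar] at h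
  simp at h
  linarith

lemma integral_abs_pow_le (hX : MemLp X (8 : ℕ) μ) (hvar : ∫ ω, X ω ^ 2 ∂μ = 1) {k : ℕ}
    (h1 : 1 ≤ k) (h8 : k ≤ 8) : ∫ ω, |X ω| ^ k ∂μ ≤ ∫ ω, X ω ^ 8 ∂μ := by
  have hm := one_le_integral_pow_eight hX hvar
  have i2 := hX.integrable_pow_of_le (k := 2) (by norm_num)
  have i8 := hX.integrable_pow_of_le (k := 8) le_rfl
  have ik := hX.integrable_abs_pow_of_le h8
  -- Exponent 1 lies outside the interpolation range and is bounded through the second moment.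
  rcases h1.eq_or_lt with rfl | h1
  · have h := integral_mono (μ := μ) (g := fun ω => 1 / 2 + 1 / 2 * X ω ^ 2) ik
      ((integrable_const _).add (i2.const_mul (1 / 2))) (fun ω => by
        simp only [pow_one]
        nlinarith [sq_abs (X ω), sq_nonneg (|X ω| - 1)])
    rw [integral_add (integrable_const _) (i2.const_mul (1 / 2)), integral_const_mul, hvar] at h
    simp at h
    simp only [pow_one]
    linarith
  · have h := integral_mono (μ := μ) (g := fun ω => (8 - k) * X ω ^ 2 + (k - 2) * X ω ^ 8)
      (ik.const_mul 6) ((i2.const_mul _).add (i8.const_mul _)) (fun ω => by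
        have := pow_le_interpolation (abs_nonneg (X ω)) h1 h8
        simpa [sq_abs, show |X ω| ^ 8 = X ω ^ 8 from (by decide : Even 8).pow_abs _] using this)
    rw [integral_add (i2.const_mul _) (i8.const_mul _), integral_const_mul, integral_const_mul,
      integral_const_mul, hvar] at h
    have hk : (k : ℝ) ≤ 8 := by exact_mod_cast h8
    nlinarith

end Moments

lemma isStandardSplitting_of_iid {Ω : Type*} [MeasurableSpace Ω] {μ : Measure Ω}
    [IsProbabilityMeasure μ] {n : ℕ} {X₀ : Ω → ℝ} {X : Fin n → Ω → ℝ} (hindep : iIndepFun X μ)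
    (hident : ∀ i, IdentDistrib (X i) X₀ μ μ) (hmean : ∫ ω, X₀ ω ∂μ = 0)
    (hvar : ∫ ω, X₀ ω ^ 2 ∂μ = 1) (hX₀ : MemLp X₀ (8 : ℕ) μ) {d : ℝ} (hd : 0 ≤ d)
    (hn : n * d ^ 2 = 1) (i : Fin n) :
    IsStandardSplitting μ (∑ j ∈ Finset.univ.erase i, fun ω => d * X j ω) (fun ω => d * X i ω)
      d (∫ ω, X₀ ω ^ 8 ∂μ) (∫ ω, X₀ ω ^ 3 ∂μ) := by
  have hpow : ∀ j k, ∫ ω, X j ω ^ k ∂μ = ∫ ω, X₀ ω ^ k ∂μ := fun j k => (hident j).pow.integral_eq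
  have hXm : ∀ j, ∫ ω, X j ω ∂μ = 0 := fun j => (hident j).integral_eq.trans hmean
  have hX : ∀ j, MemLp (X j) (8 : ℕ) μ := fun j => (hident j).memLp_iff.2 hX₀
  have hξ : ∀ j, MemLp (fun ω => d * X j ω) (8 : ℕ) μ := fun j => (hX j).const_mul d
  have hξi : iIndepFun (fun j ω => d * X j ω) μ :=
    hindep.comp (fun _ x => d * x) fun _ => by fun_prop
  have hY : MemLp (∑ j ∈ Finset.univ.erase i, fun ω => d * X j ω) (8 : ℕ) μ :=
    memLp_finsetSum' _ fun j _ => hξ j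
  have hvarj : ∀ j, Var[fun ω => d * X j ω; μ] = d ^ 2 := by
    intro j
    rw [variance_const_mul, variance_of_integral_eq_zero (hX j).1.aemeasurable (hXm j), hpow, hvar,
      mul_one]
  have habs : ∀ k, 1 ≤ k → k ≤ 8 → ∫ ω, |d * X i ω| ^ k ∂μ ≤ d ^ k * ∫ ω, X₀ ω ^ 8 ∂μ := by
    intro k h1 h8
    simp only [abs_mul, mul_pow, abs_of_nonneg hd]
    rw [integral_const_mul, ← hpow i 8]
    exact mul_le_mul_of_nonneg_left
      (integral_abs_pow_le (hX i) ((hpow i 2).trans hvar) h1 h8) (pow_nonneg hd k)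
  refine ⟨?_, hY, hξ i, ?_, ?_, ?_, ?_, habs⟩
  · exact (hξi.indepFun_finsetSum_of_notMem₀ (fun j => (hξ j).1.aemeasurable)
      (Finset.notMem_erase i _)).symm
  · rw [integral_const_mul, hXm, mul_zero]
  · simp only [mul_pow]
    rw [integral_const_mul, hpow, hvar, mul_one]
  · simp only [mul_pow]
    rw [integral_const_mul, hpow]
  · have hY0 : ∫ ω, (∑ j ∈ Finset.univ.erase i, fun ω => d * X j ω) ω ∂μ = 0 := by
      simp only [Finset.sum_apply]
      rw [integral_finsetSum _ fun j _ => (hξ j).integrable (by norm_num)]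
      refine Finset.sum_eq_zero fun j _ => ?_
      rw [integral_const_mul, hXm, mul_zero]
    rw [← variance_of_integral_eq_zero hY.1.aemeasurable hY0,
      IndepFun.variance_sum (fun j _ => (hξ j).mono_exponent (by norm_num))
        (fun j _ k _ hjk => hξi.indepFun hjk)]
    simp only [hvarj]
    -- The variance of `Y` is `d ^ 2` times the number of remaining indices, which is at most `n`.
    rw [← hn]
    simp only [Finset.sum_const, nsmul_eq_mul]
    refine mul_le_mul_of_nonneg_right ?_ (sq_nonneg d)
    exact_mod_cast (Finset.card_le_univ _).trans_eq (Fintype.card_fin n)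

/-! ### Chi-square as a squared normal, and regularization at `0` -/

lemma integral_chiSquareMeasure_one (h : ℝ → ℝ) :
    ∫ t, h t ∂(chiSquareMeasure 1) = ∫ z, h (z ^ 2) ∂(gaussianReal 0 1) := by
  rw [integral_gaussianReal_eq_integral_smul (by norm_num), chiSquareMeasure, gammaMeasure,
    integral_withDensity_eq_integral_toReal_smul (by exact (measurable_gammaPDFReal _ _).ennreal_ofReal)
      (Eventually.of_forall fun x => by simp [gammaPDF])]
  have e1 : ∀ z : ℝ, gaussianPDFReal 0 1 z • h (z ^ 2) = gaussianPDFReal 0 1 |z| • h (|z| ^ 2) := by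
    intro z
    simp [gaussianPDFReal, sq_abs]
  rw [integral_congr_ae (Eventually.of_forall e1),
    integral_comp_abs (f := fun z => gaussianPDFReal 0 1 z • h (z ^ 2))]
  have e2 : ∫ t, (gammaPDF (1 / 2) (1 / 2) t).toReal • h t
      = ∫ t in Set.Ioi 0, (gammaPDF (1 / 2) (1 / 2) t).toReal • h t := by
    rw [← integral_Ici_eq_integral_Ioi, setIntegral_eq_integral_of_forall_compl_eq_zero]
    intro x hx
    rw [gammaPDF_of_neg (by simpa using hx)]
    simp
  -- The substitution `t = z ^ 2`; its Jacobian cancels the density factor `t ^ (-1/2)` and leaves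
  -- the 2 from folding the Gaussian.
  rw [e2, ← integral_comp_rpow_Ioi_of_pos (p := 2) (by norm_num), ← integral_const_mul]
  refine setIntegral_congr_fun measurableSet_Ioi fun z (hz : 0 < z) => ?_
  simp only [smul_eq_mul, Real.rpow_two]
  rw [gammaPDF_of_nonneg (by positivity), ENNReal.toReal_ofReal (by positivity), Real.Gamma_one_half_eq,
    gaussianPDFReal]
  have e3 : (z ^ 2) ^ ((1 : ℝ) / 2 - 1) = z⁻¹ := by
    rw [← Real.rpow_natCast, ← Real.rpow_mul hz.le, ← Real.rpow_neg_one]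
    norm_num
  have e4 : (1 / 2 : ℝ) ^ ((1 : ℝ) / 2) / √Real.pi = (√(2 * Real.pi))⁻¹ := by
    rw [← Real.sqrt_eq_rpow, ← Real.sqrt_div (by norm_num), ← Real.sqrt_inv]
    congr 1
    field_simp
  rw [e3, e4]
  norm_num
  have e5 : -(1 / 2 * z ^ 2) = -z ^ 2 / 2 := by ring
  rw [e5]
  field_simp

lemma IsCbHalfLine.abs_le_halfLineSupNorm {k : ℕ} {h : ℝ → ℝ} (hh : IsCbHalfLine k h) {j : ℕ}
    (hj : j ≤ k) {x : ℝ} (hx : 0 < x) :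
    |iteratedDeriv j h x| ≤ halfLineSupNorm (iteratedDeriv j h) := by
  obtain ⟨C, hC⟩ := hh.bounded j hj
  exact le_ciSup (f := fun x : Set.Ioi (0 : ℝ) => |iteratedDeriv j h x|)
    ⟨C, by rintro _ ⟨y, rfl⟩; exact hC y y.2⟩ ⟨x, hx⟩

lemma IsCbHalfLine.hasDerivAt {k : ℕ} {h : ℝ → ℝ} (hh : IsCbHalfLine k h) {j : ℕ}
    (hj : j < k) {x : ℝ} (hx : 0 < x) :
    HasDerivAt (iteratedDeriv j h) (iteratedDeriv (j + 1) h x) x := by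
  rw [iteratedDeriv_succ]
  exact ((hh.differentiableOn j hj x hx).differentiableAt (Ioi_mem_nhds hx)).hasDerivAt

lemma halfLineSupNorm_nonneg (f : ℝ → ℝ) : 0 ≤ halfLineSupNorm f :=
  Real.iSup_nonneg fun _ => abs_nonneg _

/-- The shift keeps the argument in the open half-line, so the chain rule applies also at `s = 0`,
and the bounds do not depend on `ε`. -/
lemma IsCbHalfLine.isSquareFunction_shift {k : ℕ} {h : ℝ → ℝ} (hh : IsCbHalfLine k h) (hk : 2 ≤ k)
    {ε : ℝ} (hε : 0 < ε) :
    IsSquareFunction (fun s => h (s ^ 2 + ε)) (fun s => 2 * s * iteratedDeriv 1 h (s ^ 2 + ε))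
      (fun s => 2 * iteratedDeriv 1 h (s ^ 2 + ε) + 4 * s ^ 2 * iteratedDeriv 2 h (s ^ 2 + ε))
      (halfLineSupNorm (iteratedDeriv 1 h)) (halfLineSupNorm (iteratedDeriv 2 h)) := by
  have hpos : ∀ s : ℝ, 0 < s ^ 2 + ε := fun s => by positivity
  have hsq : ∀ s : ℝ, HasDerivAt (fun s => s ^ 2 + ε) (2 * s) s := fun s => by
    simpa using (hasDerivAt_pow 2 s).add_const ε
  have d0 : ∀ x, 0 < x → HasDerivAt h (iteratedDeriv 1 h x) x := fun x hx => by
    simpa using hh.hasDerivAt (j := 0) (by omega) hx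
  have b1 : ∀ s : ℝ, |iteratedDeriv 1 h (s ^ 2 + ε)| ≤ halfLineSupNorm (iteratedDeriv 1 h) :=
    fun s => hh.abs_le_halfLineSupNorm (by omega) (hpos s)
  have b2 : ∀ s : ℝ, |iteratedDeriv 2 h (s ^ 2 + ε)| ≤ halfLineSupNorm (iteratedDeriv 2 h) :=
    fun s => hh.abs_le_halfLineSupNorm hk (hpos s)
  refine ⟨fun s => ?_, fun s => ?_, fun s => by simp, fun s => by simp, fun s t => ?_, fun s => ?_,
    fun s => ?_⟩
  · exact ((d0 _ (hpos s)).scomp s (hsq s))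
  · have h1 := (hh.hasDerivAt (j := 1) (by omega) (hpos s)).scomp s (hsq s)
    refine (((hasDerivAt_id s).const_mul 2).mul h1).congr_deriv ?_
    simp
    ring
  · have h1 := (convex_Ioi (0 : ℝ)).norm_image_sub_le_of_norm_hasDerivWithin_le (f := h)
      (C := halfLineSupNorm (iteratedDeriv 1 h))
      (fun x hx => (d0 x hx).hasDerivWithinAt)
      (fun x hx => hh.abs_le_halfLineSupNorm (by omega) hx) (hpos t) (hpos s)
    refine h1.trans (mul_le_mul_of_nonneg_left ?_ (halfLineSupNorm_nonneg _))
    rw [Real.norm_eq_abs, abs_le]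
    constructor <;> nlinarith [sq_nonneg s, sq_nonneg t]
  · rw [abs_mul, abs_mul, abs_two]
    nlinarith [mul_le_mul_of_nonneg_left (b1 s) (abs_nonneg s)]
  · refine (abs_add_le _ _).trans ?_
    rw [abs_mul, abs_two, abs_mul, abs_of_nonneg (by positivity : 0 ≤ 4 * s ^ 2)]
    nlinarith [mul_le_mul_of_nonneg_left (b2 s) (sq_nonneg s), b1 s]

/-- Dominated convergence: `h` is bounded, and continuity from the right at `0` covers the points
where `T` vanishes. -/
lemma IsCbHalfLine.tendsto_integral_shift {k : ℕ} {h : ℝ → ℝ} (hh : IsCbHalfLine k h)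
    {Ω : Type*} [MeasurableSpace Ω] {μ : Measure Ω} [IsFiniteMeasure μ] {T : Ω → ℝ}
    (hT : AEStronglyMeasurable T μ) :
    Tendsto (fun m : ℕ => ∫ ω, h (T ω ^ 2 + 1 / ((m : ℝ) + 1)) ∂μ) atTop
      (𝓝 (∫ ω, h (T ω ^ 2) ∂μ)) := by
  have hpos : ∀ (m : ℕ) (s : ℝ), 0 < s ^ 2 + 1 / ((m : ℝ) + 1) := fun m s => by positivity
  refine tendsto_integral_of_dominated_convergence
    (fun _ => halfLineSupNorm (iteratedDeriv 0 h)) (fun m => ?_) (integrable_const _)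
    (fun m => Eventually.of_forall fun ω => ?_) (Eventually.of_forall fun ω => ?_)
  · have hc : Continuous fun s : ℝ => h (s ^ 2 + 1 / ((m : ℝ) + 1)) :=
      hh.continuousOn.comp_continuous (by fun_prop) fun s => (hpos m s).le
    exact hc.comp_aestronglyMeasurable hT
  · simpa using hh.abs_le_halfLineSupNorm (j := 0) (Nat.zero_le _) (hpos m (T ω))
  · refine (hh.continuousOn (T ω ^ 2) (sq_nonneg (T ω))).tendsto.comp
      (tendsto_nhdsWithin_iff.2 ⟨?_, Eventually.of_forall fun m => (hpos m (T ω)).le⟩)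
    simpa using tendsto_one_div_add_atTop_nhds_zero_nat.const_add (T ω ^ 2)

/-! ### The main theorem -/

theorem theorem3p1 {Ω : Type*} [MeasurableSpace Ω] (μ : Measure Ω) [IsProbabilityMeasure μ]
    (n : ℕ) (hn : 1 ≤ n)
    (X₀ : Ω → ℝ) (X : Fin n → Ω → ℝ)
    (hindep : iIndepFun X μ)
    (hident : ∀ i, IdentDistrib (X i) X₀ μ μ)
    (hmean : ∫ ω, X₀ ω ∂μ = 0)
    (hvar : ∫ ω, X₀ ω ^ 2 ∂μ = 1)
    (hmom : Integrable (fun ω => X₀ ω ^ 8) μ)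
    (h : ℝ → ℝ) (hh : IsCbHalfLine 3 h) :
    |(∫ ω, h ((1 / (n : ℝ)) * (∑ i, X i ω) ^ 2) ∂μ) - ∫ t, h t ∂(chiSquareMeasure 1)| ≤
      4 * (∫ ω, X₀ ω ^ 8 ∂μ) / (3 * (n : ℝ)) *
        ((2 + 69 * |∫ ω, X₀ ω ^ 3 ∂μ|) * halfLineSupNorm h
          + (38 + 654 * |∫ ω, X₀ ω ^ 3 ∂μ|) * halfLineSupNorm (iteratedDeriv 1 h)
          + (203 + 1781 * |∫ ω, X₀ ω ^ 3 ∂μ|) * halfLineSupNorm (iteratedDeriv 2 h)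
          + (321 + 1320 * |∫ ω, X₀ ω ^ 3 ∂μ|) * halfLineSupNorm (iteratedDeriv 3 h)) := by
  have hn0 : (0 : ℝ) < n := by exact_mod_cast hn
  have hn1 : (1 : ℝ) ≤ n := by exact_mod_cast hn
  set d : ℝ := √(1 / n)
  have hd : 0 ≤ d := Real.sqrt_nonneg _
  have hd2 : d ^ 2 = 1 / n := Real.sq_sqrt (by positivity)
  have hnd : n * d ^ 2 = 1 := by rw [hd2]; field_simp
  have hd1 : d ≤ 1 := by
    rw [← sq_le_one_iff₀ hd, hd2, div_le_one hn0]
    exact hn1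
  -- Measurability is read off from equality in law with the first variable, which exists because `1
  -- ≤ n`.
  have hX₀m : AEStronglyMeasurable X₀ μ := (hident ⟨0, hn⟩).aemeasurable_snd.aestronglyMeasurable
  have hX₀ : MemLp X₀ (8 : ℕ) μ := by
    rw [← integrable_norm_rpow_iff hX₀m (by norm_num) (by norm_num)]
    refine hmom.congr (Eventually.of_forall fun ω => ?_)
    simp only [ENNReal.toReal_natCast, Real.rpow_natCast, Real.norm_eq_abs]
    exact ((by decide : Even 8).pow_abs _).symm
  have hm := one_le_integral_pow_eight hX₀ hvar
  set m := ∫ ω, X₀ ω ^ 8 ∂μ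
  set γ := ∫ ω, X₀ ω ^ 3 ∂μ
  set a := halfLineSupNorm (iteratedDeriv 1 h)
  set b := halfLineSupNorm (iteratedDeriv 2 h)
  have ha : 0 ≤ a := halfLineSupNorm_nonneg _
  have hb : 0 ≤ b := halfLineSupNorm_nonneg _
  set S : Ω → ℝ := fun ω => ∑ i, d * X i ω with hS
  have hSm : AEStronglyMeasurable S μ :=
    (memLp_finsetSum _ fun i _ => ((hident i).memLp_iff.2 hX₀).const_mul d).1
  have hsplit := isStandardSplitting_of_iid hindep hident hmean hvar hX₀ hd hnd
  have hSY : ∀ i ω, S ω = (∑ j ∈ Finset.univ.erase i, fun ω => d * X j ω) ω + d * X i ω := by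
    intro i ω
    rw [Finset.sum_apply, Finset.sum_erase_add _ _ (Finset.mem_univ i)]
  have hshift : ∀ ε : ℝ, 0 < ε → |∫ ω, h (S ω ^ 2 + ε) ∂μ - ∫ z, h (z ^ 2 + ε) ∂(gaussianReal 0 1)|
      ≤ d ^ 2 * m * (48 * a + 80 / 3 * b + |γ| * (414 * a + 143 * b)) := fun ε hε =>
    abs_integral_sub_integral_gaussianReal_le hsplit hSY (fun _ => rfl) hd hd1 hnd (by linarith) hb
      (hh.isSquareFunction_shift (by norm_num) hε)
  have hlim : |∫ ω, h (S ω ^ 2) ∂μ - ∫ z, h (z ^ 2) ∂(gaussianReal 0 1)|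
      ≤ d ^ 2 * m * (48 * a + 80 / 3 * b + |γ| * (414 * a + 143 * b)) :=
    le_of_tendsto ((hh.tendsto_integral_shift hSm).sub
      (hh.tendsto_integral_shift (T := fun z => z) (by fun_prop))).abs
      (Eventually.of_forall fun k => hshift _ (by positivity))
  have hW : ∀ ω, (1 / (n : ℝ)) * (∑ i, X i ω) ^ 2 = S ω ^ 2 := by
    intro ω
    simp only [hS, ← Finset.mul_sum, mul_pow, hd2]
  simp only [hW]
  rw [integral_chiSquareMeasure_one]
  refine hlim.trans ?_
  have h0 : 0 ≤ (2 + 69 * |γ|) * halfLineSupNorm h :=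
    mul_nonneg (by positivity) (halfLineSupNorm_nonneg _)
  have h3 : 0 ≤ (321 + 1320 * |γ|) * halfLineSupNorm (iteratedDeriv 3 h) :=
    mul_nonneg (by positivity) (halfLineSupNorm_nonneg _)
  -- With `4 / 3` moved inside, coefficients are compared one by one: `48 ≤ 4/3 * 38`, `80/3 ≤ 4/3 *
  -- 203`, `414 ≤ 4/3 * 654`, `143 ≤ 4/3 * 1781`. The other two terms are nonnegative.
  rw [hd2, show 4 * m / (3 * (n : ℝ)) = 1 / n * m * (4 / 3) by field_simp, mul_assoc _ (4 / 3 : ℝ)]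
  refine mul_le_mul_of_nonneg_left ?_ (by positivity)
  have g1 : 0 ≤ |γ| * a := by positivity
  have g2 : 0 ≤ |γ| * b := by positivity
  nlinarith
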